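/- Fix $\epsilon\in[0,1]$ and $R<1-\epsilon$. For $N=2^n$, $n\to\infty$, let $\mathcal P(N,K_N)$ be polar codes with $K_N/N\le R$ for all sufficiently large $N$: $\mathbf c^T=\mathbf u^T\mathbf G_N$ over $\mathrm{GF}(2)$, where $\mathbf G_N=\mathbf B_N\mathbf F^{\otimes n}$, $\mathbf F=\begin{bmatrix}1&0\\1&1\end{bmatrix}$, $\mathbf B_N$ is the bit-reversal permutation, and $\mathbf u$ vanishes outside an information set $\mathbb A_N$ of $K_N$ indices with smallest Bhattacharyya parameters for the binary erasure channel $\mathrm{BEC}(\epsilon)$. (These parameters are given by $Z=\epsilon$ for $n=0$ and, on appending a bit $0$ or $1$ at the least significant end of the binary index, by $Z\mapsto 2Z-Z^2$ or $Z\mapsto Z^2$ respectively; ties are broken arbitrarily.) A codeword is sent over the memoryless $\mathrm{BEC}(\epsilon)$; the information word may have any distribution. Let $\mathbf H_N$ be a pruned parity-check matrix (PCM) of the code. It is obtained from the standard polar factor graph ($N\log_2N$ checks, $N(1+\log_2N)$ variables) by deleting the frozen variables (inputs $u_i$ with $i\notin\mathbb A_N$, which are zero) and then applying the following steps, in any order,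 until none applies; "channel variables" are the codeword bits and "hidden variables" are all other variables: (i) remove a check of degree 1 with its variable; (ii) for a check of degree 2 joining a channel variable and a hidden variable, or two hidden variables, remove the check and merge the two variables (keeping the channel variable, if there is one); (iii) remove a hidden variable of degree 1 with its check; (iv) remove a hidden variable of degree 2 and merge (add modulo 2) its two checks. The decoder works as follows. Stage 1: run belief propagation on $\mathbf H_N$ until convergence, i.e. start from the unerased channel variables and, as long as some check has exactly one unknown variable, decode that variable. Stage 2: as long as there are variables that are not decoded, not reference variables and not diagonalized ("remaining" variables), do the following. If some row of $\mathbf H_N$ has exactly one remaining variable, place that row and that variable on the diagonal (the variable is then diagonalized). Otherwise declare some nonempty set of remaining variables to be reference variables; the set may be chosen by any rule, possibly random. Let $n_r$ be the final number of reference variables, and let $n_e$ be the number of rows that are neither decoded (all their variables decoded in stage 1) nor on the diagonal. In particular $n_r=n_e=0$ if belief propagation decodes all variables. The later stages express the diagonalized variables through the $n_r$ reference variables and solve the remaining $n_e$ linear equations for these. Then for all real $q,p>0$, $$\lim_{N\to\infty}\mathrm E\left\{(N\log N)\,n_r^{\,q}\, n_e^{\,p}\right\}=0 .$$ -/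

import Mathlib

open Filter Topology MeasureTheory

namespace PolarBEC

noncomputable section

/-! ### Polar codes -/

/-- Indices `0, …, N - 1` with `N = 2 ^ n`, written in binary, most significant bit first. -/
abbrev Idx (n : ℕ) : Type := Fin n → Fin 2

/-- Bit reversal of an index. -/
def bitRev {n : ℕ} : Equiv.Perm (Idx n) where
  toFun i := i ∘ Fin.rev
  invFun i := i ∘ Fin.rev
  left_inv i := by funext k; simp
  right_inv i := by funext k; simp

/-- The kernel `F`. -/
def kernelF : Matrix (Fin 2) (Fin 2) (ZMod 2) := !![1, 0; 1, 1]

/-- The `n`-fold Kronecker power of `F`. -/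
def kronPow (n : ℕ) : Matrix (Idx n) (Idx n) (ZMod 2) :=
  Matrix.of fun a b => ∏ k, kernelF (a k) (b k)

/-- The bit reversal permutation matrix `B_N`. -/
def bitRevMatrix (n : ℕ) : Matrix (Idx n) (Idx n) (ZMod 2) :=
  Matrix.of fun a b => if b = bitRev a then 1 else 0

/-- The polar generator matrix `G_N = B_N F^{⊗ n}`. -/
def generator (n : ℕ) : Matrix (Idx n) (Idx n) (ZMod 2) := bitRevMatrix n * kronPow n

/-- The codeword `c` with `cᵀ = uᵀ G_N`. -/
def encode {n : ℕ} (u : Idx n → ZMod 2) : Idx n → ZMod 2 := Matrix.vecMul u (generator n)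

/-- The Bhattacharyya parameter (here: the erasure probability) of the bit channel with a given
index, for the BEC with erasure probability `ε`. Appending the bit `0` (`1`) to an index is
passing from a channel to its worse (better) transform. -/
def bhattacharyya (ε : ℝ) : (n : ℕ) → Idx n → ℝ
  | 0, _ => ε
  | n + 1, i =>
    let z := bhattacharyya ε n (Fin.init i)
    if i (Fin.last n) = 0 then 2 * z - z ^ 2 else z ^ 2

/-- `A` is an information set of the polar code `𝒫(2 ^ n, K)` designed for the BEC with erasure
probability `ε`: it consists of `K` indices with smallest Bhattacharyya parameters (ties are
broken in any way). -/
def IsInfoSet (ε : ℝ) {n : ℕ} (K : ℕ) (A : Finset (Idx n)) : Prop :=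
  A.card = K ∧ ∀ i ∈ A, ∀ j ∉ A, bhattacharyya ε n i ≤ bhattacharyya ε n j

/-! ### Parity check matrices (Tanner graphs) and their pruning -/

/-- A parity check matrix, whose columns (variable nodes) are the elements of `cols` and whose
rows (parity check nodes) are the elements of `rows`. The entries of `mat` outside these rows and
columns have no meaning. -/
structure PCM (V C : Type*) where
  cols : Finset V
  rows : Finset C
  mat : Matrix C V (ZMod 2)

section graph

variable {V C : Type*} [DecidableEq V] [DecidableEq C]

/-- The variable nodes adjacent to a check node. -/
def PCM.varsOf (H : PCM V C) (r : C) : Finset V := H.cols.filter fun v => H.mat r v ≠ 0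

/-- The check nodes adjacent to a variable node. -/
def PCM.checksOf (H : PCM V C) (v : V) : Finset C := H.rows.filter fun r => H.mat r v ≠ 0

/-- Remove a check node and a variable node. -/
def PCM.remove (H : PCM V C) (r : C) (v : V) : PCM V C :=
  { cols := H.cols.erase v, rows := H.rows.erase r, mat := H.mat }

/-- Remove a check node and merge the variable node `w` into the variable node `v` (the columns
are added modulo 2, as both variables have the same value). -/
def PCM.mergeVars (H : PCM V C) (r : C) (v w : V) : PCM V C :=
  { cols := H.cols.erase w
    rows := H.rows.erase r
    mat := H.mat.updateCol v fun t => H.mat t v + H.mat t w }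

/-- Remove the variable node `v` and merge the check node `s` into the check node `r` (the rows
are added modulo 2). -/
def PCM.mergeChecks (H : PCM V C) (r s : C) (v : V) : PCM V C :=
  { cols := H.cols.erase v
    rows := H.rows.erase s
    mat := H.mat.updateRow r (H.mat r + H.mat s) }

/-- One pruning step on a graph without frozen variable nodes. `isCVN v` says that `v` is a channel
variable node; all other variable nodes are hidden. -/
inductive PruneStep (isCVN : V → Prop) : PCM V C → PCM V C → Prop
  /-- a check node of degree 1: its neighbor is zero, and both are removed -/
  | checkDegOne (H : PCM V C) (r : C) (v : V) (hr : r ∈ H.rows) (h : H.varsOf r = {v}) :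
      PruneStep isCVN H (H.remove r v)
  /-- a check node of degree 2 between a channel variable node `v` and a hidden one `w` -/
  | channelHidden (H : PCM V C) (r : C) (v w : V) (hr : r ∈ H.rows) (hvw : v ≠ w)
      (h : H.varsOf r = {v, w}) (hv : isCVN v) (hw : ¬ isCVN w) :
      PruneStep isCVN H (H.mergeVars r v w)
  /-- a hidden variable node of degree 1 -/
  | hiddenDegOne (H : PCM V C) (v : V) (r : C) (hv : v ∈ H.cols) (hh : ¬ isCVN v)
      (h : H.checksOf v = {r}) :
      PruneStep isCVN H (H.remove r v)
  /-- a hidden variable node of degree 2 -/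
  | hiddenDegTwo (H : PCM V C) (v : V) (r s : C) (hv : v ∈ H.cols) (hh : ¬ isCVN v) (hrs : r ≠ s)
      (h : H.checksOf v = {r, s}) :
      PruneStep isCVN H (H.mergeChecks r s v)
  /-- a check node of degree 2 between two hidden variable nodes -/
  | hiddenHidden (H : PCM V C) (r : C) (v w : V) (hr : r ∈ H.rows) (hvw : v ≠ w)
      (h : H.varsOf r = {v, w}) (hv : ¬ isCVN v) (hw : ¬ isCVN w) :
      PruneStep isCVN H (H.mergeVars r v w)

end graph

/-- Variable nodes of the standard factor graph: a layer `0, …, n` and a position in it. Layer `0`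
holds the information word, layer `n` the codeword. -/
abbrev VarNode (n : ℕ) : Type := Fin (n + 1) × Idx n

/-- Parity check nodes of the standard factor graph: a stage `0, …, n - 1` and a position in it. -/
abbrev CheckNode (n : ℕ) : Type := Fin n × Idx n

/-- The matrix of the standard factor graph, of size `N log₂ N × N (1 + log₂ N)`. Stage `l` computes
layer `l + 1` from layer `l` by butterflies acting on the bit of weight `2 ^ l` of the position: with
`k` the place of that bit, the node at position `i` of layer `l + 1` equals the node at position `i`
of layer `l`, plus, if `i k = 0`, the node of layer `l` at the position where that bit is changed
to `1`. -/
def fgMatrix (n : ℕ) : Matrix (CheckNode n) (VarNode n) (ZMod 2) :=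
  Matrix.of fun c v =>
    if (v.1 = c.1.succ ∧ v.2 = c.2) ∨
        (v.1 = c.1.castSucc ∧
          (v.2 = c.2 ∨ (c.2 c.1.rev = 0 ∧ v.2 = Function.update c.2 c.1.rev 1)))
    then 1 else 0

/-- Channel variable nodes: those of the last layer. -/
def IsCVN {n : ℕ} (v : VarNode n) : Prop := v.1 = Fin.last n

/-- The standard factor graph after the removal of the frozen variable nodes. -/
def unfrozenPCM {n : ℕ} (A : Finset (Idx n)) : PCM (VarNode n) (CheckNode n) :=
  { cols := Finset.univ.filter fun v => v.1 = 0 → v.2 ∈ A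
    rows := Finset.univ
    mat := fgMatrix n }

/-- `H` is a pruned parity check matrix of the polar code with information set `A`: it is obtained
by frozen node removal followed by pruning steps, in any order, until none is applicable. -/
def IsPrunedPCM {n : ℕ} (A : Finset (Idx n)) (H : PCM (VarNode n) (CheckNode n)) : Prop :=
  Relation.ReflTransGen (PruneStep IsCVN) (unfrozenPCM A) H ∧ ∀ H', ¬ PruneStep IsCVN H H'

/-! ### The channel -/

/-- Transition probabilities of the binary erasure channel (`none` is an erasure). -/
def becProb (ε : ℝ) (x : ZMod 2) : Option (ZMod 2) → ℝ
  | none => ε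
  | some b => if b = x then 1 - ε else 0

/-- `u` is a random information word (of any distribution) with zero frozen bits, and `y` is the
output of the memoryless BEC with erasure probability `ε` when the codeword of `u` is sent. -/
structure IsTransmission {n : ℕ} (ε : ℝ) (A : Finset (Idx n)) {Ω : Type*} [MeasurableSpace Ω]
    (P : Measure Ω) (u : Ω → Idx n → ZMod 2) (y : Ω → Idx n → Option (ZMod 2)) : Prop where
  measurable_u : ∀ a, MeasurableSet {ω | u ω = a}
  measurable_y : ∀ b, MeasurableSet {ω | y ω = b}
  frozen : ∀ ω, ∀ i ∉ A, u ω i = 0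
  law : ∀ a b, P.real {ω | u ω = a ∧ y ω = b} =
    P.real {ω | u ω = a} * ∏ j, becProb ε (encode a j) (b j)

/-- The channel information at the variable nodes: position `i` of the last layer carries the
codeword bit with index `bitRev i`; nothing is received for the other nodes. -/
def channelInfo {n : ℕ} (y : Idx n → Option (ZMod 2)) (v : VarNode n) : Option (ZMod 2) :=
  if v.1 = Fin.last n then y (bitRev v.2) else none

/-! ### The decoder -/

section decoder

variable {V C : Type*} [DecidableEq V] [DecidableEq C]

/-- Belief propagation over the BEC, run until convergence: `BPValue H obs v b` says that the
variable node `v` is decoded to the bit `b`, either because this bit is received, or because all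
other neighbors of some check node adjacent to `v` are decoded and `b` is their sum. -/
inductive BPValue (H : PCM V C) (obs : V → Option (ZMod 2)) : V → ZMod 2 → Prop
  | channel (v : V) (b : ZMod 2) (hv : v ∈ H.cols) (h : obs v = some b) : BPValue H obs v b
  | check (r : C) (v : V) (x : V → ZMod 2) (hr : r ∈ H.rows) (hv : v ∈ H.varsOf r)
      (h : ∀ w ∈ (H.varsOf r).erase v, BPValue H obs w (x w)) :
      BPValue H obs v (∑ w ∈ (H.varsOf r).erase v, x w)

open Classical in
/-- The variable nodes decoded by belief propagation (stage 1). -/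
def bpDecoded (H : PCM V C) (obs : V → Option (ZMod 2)) : Finset V :=
  H.cols.filter fun v => ∃ b, BPValue H obs v b

/-- The state of the triangulation (stage 2): the reference variables, the variables placed on the
diagonal, and the rows placed on the diagonal. -/
structure TriState (V C : Type*) where
  refs : Finset V
  diagVars : Finset V
  diagRows : Finset C

/-- The state before the first reference variable is chosen. -/
def TriState.init : TriState V C := { refs := ∅, diagVars := ∅, diagRows := ∅ }

/-- The variables that are neither decoded (in `D`), nor reference variables, nor diagonalized. -/
def TriState.remaining (H : PCM V C) (D : Finset V) (s : TriState V C) : Finset V :=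
  H.cols \ (D ∪ s.refs ∪ s.diagVars)

/-- The diagonal can be extended by row `r` and column `v`: `v` is the only remaining variable of
the row `r`, which is not on the diagonal. -/
def TriState.Extends (H : PCM V C) (D : Finset V) (s : TriState V C) (r : C) (v : V) : Prop :=
  r ∈ H.rows ∧ r ∉ s.diagRows ∧ H.varsOf r ∩ s.remaining H D = {v}

/-- One step of the triangulation: an extension of the diagonal by one entry, or, if none is
possible, the choice of a nonempty set of additional reference variables. -/
inductive TriStep (H : PCM V C) (D : Finset V) : TriState V C → TriState V C → Prop
  | extend (s : TriState V C) (r : C) (v : V) (h : s.Extends H D r v) :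
      TriStep H D s
        { refs := s.refs, diagVars := insert v s.diagVars, diagRows := insert r s.diagRows }
  | choose (s : TriState V C) (T : Finset V) (hT : T.Nonempty) (hsub : T ⊆ s.remaining H D)
      (h : ∀ r v, ¬ s.Extends H D r v) :
      TriStep H D s
        { refs := s.refs ∪ T, diagVars := s.diagVars, diagRows := s.diagRows }

/-- The rows that are not decoded by belief propagation, i.e. not all of whose variables are in
the set `D` of decoded variables, and that are not on the diagonal. -/
def TriState.remainingRows (H : PCM V C) (D : Finset V) (s : TriState V C) : Finset C :=
  (H.rows.filter fun r => ¬ H.varsOf r ⊆ D) \ s.diagRows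

/-- With the choices made in some run of the decoder on the parity check matrix `H` and the
channel information `obs`, `nr` reference variables are used, and `ne` equations remain when all
variables are decoded, reference or diagonalized. (If belief propagation decodes all variables, no
step is made and both numbers are `0`.) -/
def IsDecoderRun (H : PCM V C) (obs : V → Option (ZMod 2)) (nr ne : ℕ) : Prop :=
  ∃ s : TriState V C,
    Relation.ReflTransGen (TriStep H (bpDecoded H obs)) TriState.init s ∧
    s.remaining H (bpDecoded H obs) = ∅ ∧
    s.refs.card = nr ∧ (s.remainingRows H (bpDecoded H obs)).card = ne

end decoder

end

end PolarBEC

/-!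
Reference variables exist only if belief propagation gets stuck, and `nr` and `ne` are at most the
numbers `(n + 1) 2 ^ n` and `n 2 ^ n` of nodes of the factor graph. So it suffices that the
probability that belief propagation gets stuck is `O((2 ^ n) ^ (-c))` for every `c`.

The variables at which belief propagation gets stuck form a stopping set. Each pruning step can be
undone by adding hidden variables to a stopping set (`PruneStep.exists_isStoppingSet`), so that a
stopping set of the pruned graph gives one of the unpruned graph with the same channel variables, all
erased. Following the butterflies from the channel to the information word, one finds in it an
information bit that successive cancellation decoding finds erased
(`IsButterflyStopping.exists_scErased`). Hence belief propagation gets stuck with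
probability at most the sum of the Bhattacharyya parameters of the information bits
(`IsTransmission.measureReal_exists_scErased_le`).

It remains to show that these are at most `(2 ^ n) ^ (-c)` for large `n`, for which
it is enough that the proportion of the indices with larger parameters is eventually below any
number above `ε` (`eventually_polarMean_indicator_le`). Let `z` be the random parameter after a number
of steps, which is a martingale. As the mean of `√(z (1 - z))` decreases exponentially, after
`m ≈ 4 n / 5` steps `z` exceeds `(4 / 5) ^ m` with probability at most `ε + o(1)`. From a value below
`(4 / 5) ^ m`, the other `k ≈ n / 5` steps cannot leave the region of small values, in which the mean
of `z ^ γ` is multiplied by at most `3 / 5` in each step. This holds for all small `γ > 0`,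
so Markov's inequality gives any exponent `c`.
-/

namespace PolarBEC

/-! ### Stopping sets and pruning -/

section stopping

variable {V C : Type*} [DecidableEq V]

/-- A stopping set of a parity check matrix: a set of variable nodes such that no check node has
exactly one neighbor in it. Belief propagation over an erasure channel cannot decode any variable of
a stopping set all of whose channel variables are erased. -/
def PCM.IsStoppingSet (H : PCM V C) (S : Set V) : Prop :=
  S ⊆ H.cols ∧ ∀ r ∈ H.rows, ∀ v ∈ S, H.mat r v ≠ 0 → ∃ w ∈ S, w ≠ v ∧ H.mat r w ≠ 0

lemma mem_bpDecoded {H : PCM V C} {obs : V → Option (ZMod 2)} {v : V} :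
    v ∈ bpDecoded H obs ↔ v ∈ H.cols ∧ ∃ b, BPValue H obs v b := by
  classical
  simp [bpDecoded]

/-- The variables that belief propagation leaves undecoded form a stopping set. -/
lemma isStoppingSet_undecoded (H : PCM V C) (obs : V → Option (ZMod 2)) :
    H.IsStoppingSet (H.cols \ bpDecoded H obs : Finset V) := by
  refine ⟨by simp, fun r hr v hv hrv => ?_⟩
  simp only [Finset.coe_sdiff, Set.mem_sdiff, Finset.mem_coe] at hv ⊢
  by_contra! hcon
  have hall : ∀ w, w ∈ (H.varsOf r).erase v → ∃ b, BPValue H obs w b := by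
    intro w hw
    obtain ⟨hwv, hw⟩ := Finset.mem_erase.1 hw
    obtain ⟨hwc, hrw⟩ := Finset.mem_filter.1 hw
    by_contra hno
    exact hrw (hcon w ⟨hwc, fun hd => hno (mem_bpDecoded.1 hd).2⟩ hwv)
  choose! x hx using hall
  exact hv.2 (mem_bpDecoded.2 ⟨hv.1, _,
    BPValue.check r v x hr (Finset.mem_filter.2 ⟨hv.1, hrv⟩) hx⟩)

/-- Received variables are decoded. -/
lemma obs_eq_none_of_undecoded {H : PCM V C} {obs : V → Option (ZMod 2)} {v : V}
    (hv : v ∈ H.cols \ bpDecoded H obs) : obs v = none := by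
  obtain ⟨hc, hd⟩ := Finset.mem_sdiff.1 hv
  by_contra hne
  obtain ⟨b, hb⟩ := Option.ne_none_iff_exists'.1 hne
  exact hd (mem_bpDecoded.2 ⟨hc, b, BPValue.channel v b hc hb⟩)

variable [DecidableEq C]

/-- Merging `w` into `v` is undone by adding `w` to the stopping sets that contain `v`. -/
lemma PCM.IsStoppingSet.of_mergeVars {H : PCM V C} {r : C} {v w : V} {S : Set V}
    (hvw : v ≠ w) (h : H.varsOf r = {v, w}) (hS : (H.mergeVars r v w).IsStoppingSet S) :
    H.IsStoppingSet (S ∪ {x | x = w ∧ v ∈ S}) := by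
  obtain ⟨hsub, hS_stop⟩ := hS
  have hmem : ∀ x, x ∈ H.varsOf r ↔ x = v ∨ x = w := by simp [h]
  simp only [PCM.varsOf, Finset.mem_filter] at hmem
  have hwS : w ∉ S := fun hw => by simpa [PCM.mergeVars] using hsub hw
  have hcols : ∀ x ∈ S, x ∈ H.cols := fun x hx => by
    have := hsub hx
    simp only [PCM.mergeVars, Finset.coe_erase] at this
    exact this.1
  have hv := (hmem v).2 (Or.inl rfl)
  have hw := (hmem w).2 (Or.inr rfl)
  refine ⟨?_, fun t ht x hx htx => ?_⟩
  · rintro x (hx | ⟨rfl, -⟩)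
    · exact hcols x hx
    · exact hw.1
  by_cases htr : t = r
  · subst htr
    have hvS : v ∈ S := by
      rcases hx with hx | ⟨-, hx⟩
      · rcases (hmem x).1 ⟨hcols x hx, htx⟩ with rfl | rfl
        · exact hx
        · exact absurd hx hwS
      · exact hx
    rcases (em (x = v)) with rfl | hxv
    · exact ⟨w, Or.inr ⟨rfl, hvS⟩, hvw.symm, hw.2⟩
    · exact ⟨v, Or.inl hvS, Ne.symm hxv, hv.2⟩
  · have key := hS_stop t (by simp [PCM.mergeVars, htr, ht])
    simp only [PCM.mergeVars, Matrix.updateCol_apply] at key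
    -- a check node adjacent to both `v` and `w` has these two neighbors in the enlarged set
    by_cases hboth : v ∈ S ∧ H.mat t v ≠ 0 ∧ H.mat t w ≠ 0
    · rcases (em (x = v)) with rfl | hxv
      · exact ⟨w, Or.inr ⟨rfl, hboth.1⟩, hvw.symm, hboth.2.2⟩
      · exact ⟨v, Or.inl hboth.1, Ne.symm hxv, hboth.2.1⟩
    have hx' : (x ∈ S ∧ x ≠ v) ∨ (v ∈ S ∧ (x = v ∨ x = w)) := by
      rcases hx with hx | ⟨rfl, hx⟩
      · rcases em (x = v) with rfl | hxv
        · exact Or.inr ⟨hx, Or.inl rfl⟩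
        · exact Or.inl ⟨hx, hxv⟩
      · exact Or.inr ⟨hx, Or.inr rfl⟩
    have lift : ∀ y ∈ S, y ≠ x → (if y = v then H.mat t v + H.mat t w else H.mat t y) ≠ 0 →
        (v ∈ S → x = w → y ≠ v) →
        ∃ z ∈ S ∪ {x | x = w ∧ v ∈ S}, z ≠ x ∧ H.mat t z ≠ 0 := by
      intro y hy hyx hne hcond
      split_ifs at hne with hyv
      · subst hyv
        by_cases h1 : H.mat t y = 0
        · refine ⟨w, Or.inr ⟨rfl, hy⟩, ?_, by simpa [h1] using hne⟩
          rintro rfl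
          exact hcond hy rfl rfl
        · exact ⟨y, Or.inl hy, hyx, h1⟩
      · exact ⟨y, Or.inl hy, hyx, hne⟩
    rcases hx' with ⟨hxS, hxv⟩ | ⟨hvS, hxvw⟩
    · obtain ⟨y, hy, hyx, hne⟩ := key x hxS (by simpa [hxv] using htx)
      exact lift y hy hyx hne fun _ hxw => absurd (hxw ▸ hxS) hwS
    · have hsum : H.mat t v + H.mat t w ≠ 0 := by
        rcases hxvw with rfl | rfl
        · have : H.mat t w = 0 := by
            by_contra h0
            exact hboth ⟨hvS, htx, h0⟩
          simpa [this] using htx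
        · have : H.mat t v = 0 := by
            by_contra h0
            exact hboth ⟨hvS, h0, htx⟩
          simpa [this] using htx
      obtain ⟨y, hy, hyv, hne⟩ := key v hvS (by simpa using hsum)
      refine lift y hy ?_ hne fun _ _ => hyv
      rcases hxvw with rfl | rfl
      · exact hyv
      · rintro rfl
        exact hwS hy

/-- Pruning creates no new obstruction to belief propagation: a stopping set of the pruned graph
extends to one of the original graph by hidden variable nodes only. -/
lemma PruneStep.exists_isStoppingSet {isCVN : V → Prop} {H H' : PCM V C}
    (h : PruneStep isCVN H H') {S : Set V} (hS : H'.IsStoppingSet S) :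
    ∃ S', H.IsStoppingSet S' ∧ S ⊆ S' ∧ ∀ v ∈ S', isCVN v → v ∈ S := by
  cases h with
  | checkDegOne r v hr h =>
    obtain ⟨hsub, hS_stop⟩ := hS
    have hsub' : ∀ x ∈ S, x ≠ v ∧ x ∈ H.cols := fun x hx => by
      simpa [PCM.remove, and_comm] using hsub hx
    refine ⟨S, ⟨fun x hx => (hsub' x hx).2, fun t ht x hx htx => ?_⟩, subset_rfl, fun _ hx _ => hx⟩
    by_cases htr : t = r
    · subst htr
      have : x ∈ H.varsOf t := Finset.mem_filter.2 ⟨(hsub' x hx).2, htx⟩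
      rw [h, Finset.mem_singleton] at this
      exact absurd this (hsub' x hx).1
    · exact hS_stop t (by simp [PCM.remove, htr, ht]) x hx htx
  | channelHidden r v w hr hvw h hv hw =>
    refine ⟨_, hS.of_mergeVars hvw h, Set.subset_union_left, ?_⟩
    rintro x (hx | ⟨rfl, -⟩) hc
    · exact hx
    · exact absurd hc hw
  | hiddenHidden r v w hr hvw h hv hw =>
    refine ⟨_, hS.of_mergeVars hvw h, Set.subset_union_left, ?_⟩
    rintro x (hx | ⟨rfl, -⟩) hc
    · exact hx
    · exact absurd hc hw
  | hiddenDegOne v r hv hh h =>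
    obtain ⟨hsub, hS_stop⟩ := hS
    have hsub' : ∀ x ∈ S, x ≠ v ∧ x ∈ H.cols := fun x hx => by
      simpa [PCM.remove, and_comm] using hsub hx
    have hmem : ∀ t, t ∈ H.rows ∧ H.mat t v ≠ 0 ↔ t = r := fun t => by
      rw [← Finset.mem_singleton, ← h, PCM.checksOf, Finset.mem_filter]
    have hr := (hmem r).2 rfl
    have key : ∀ t ∈ H.rows, t ≠ r → ∀ x ∈ S, H.mat t x ≠ 0 → ∃ w ∈ S, w ≠ x ∧ H.mat t w ≠ 0 :=
      fun t ht htr => hS_stop t (by simp [PCM.remove, htr, ht])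
    by_cases hex : ∃ x ∈ S, H.mat r x ≠ 0
    · obtain ⟨x₀, hx₀, hrx₀⟩ := hex
      refine ⟨insert v S, ⟨?_, fun t ht x hx htx => ?_⟩, Set.subset_insert _ _, ?_⟩
      · rintro x (rfl | hx)
        · exact hv
        · exact (hsub' x hx).2
      · rcases hx with rfl | hx
        · obtain rfl := (hmem t).1 ⟨ht, htx⟩
          exact ⟨x₀, Or.inr hx₀, (hsub' _ hx₀).1, hrx₀⟩
        · by_cases htr : t = r
          · subst htr
            exact ⟨v, Or.inl rfl, (hsub' x hx).1.symm, hr.2⟩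
          · obtain ⟨w, hw, h1⟩ := key t ht htr x hx htx
            exact ⟨w, Or.inr hw, h1⟩
      · rintro x (rfl | hx) hc
        · exact absurd hc hh
        · exact hx
    · refine ⟨S, ⟨fun x hx => (hsub' x hx).2, fun t ht x hx htx => ?_⟩, subset_rfl,
        fun _ hx _ => hx⟩
      by_cases htr : t = r
      · subst htr
        exact absurd ⟨x, hx, htx⟩ hex
      · exact key t ht htr x hx htx
  | hiddenDegTwo v r s hv hh hrs h =>
    obtain ⟨hsub, hS_stop⟩ := hS
    have hsub' : ∀ x ∈ S, x ≠ v ∧ x ∈ H.cols := fun x hx => by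
      simpa [PCM.mergeChecks, and_comm] using hsub hx
    have hmem : ∀ t, t ∈ H.rows ∧ H.mat t v ≠ 0 ↔ t = r ∨ t = s := fun t => by
      have : t = r ∨ t = s ↔ t ∈ H.checksOf v := by simp [h]
      rw [this, PCM.checksOf, Finset.mem_filter]
    have hr := (hmem r).2 (Or.inl rfl)
    have hs := (hmem s).2 (Or.inr rfl)
    have key : ∀ t ∈ H.rows, t ≠ r → t ≠ s → ∀ x ∈ S, H.mat t x ≠ 0 →
        ∃ w ∈ S, w ≠ x ∧ H.mat t w ≠ 0 := fun t ht htr hts => by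
      have := hS_stop t (by simp [PCM.mergeChecks, hts, ht])
      simpa [PCM.mergeChecks, Matrix.updateRow_apply, htr] using this
    have keyr : ∀ x ∈ S, H.mat r x + H.mat s x ≠ 0 →
        ∃ w ∈ S, w ≠ x ∧ H.mat r w + H.mat s w ≠ 0 := by
      have := hS_stop r (by simp [PCM.mergeChecks, hrs, hr.1])
      simpa [PCM.mergeChecks, Matrix.updateRow_apply] using this
    by_cases hex : (∃ x ∈ S, H.mat r x ≠ 0) ∧ ∃ x ∈ S, H.mat s x ≠ 0
    · obtain ⟨⟨x₀, hx₀, hrx₀⟩, ⟨x₁, hx₁, hsx₁⟩⟩ := hex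
      refine ⟨insert v S, ⟨?_, fun t ht x hx htx => ?_⟩, Set.subset_insert _ _, ?_⟩
      · rintro x (rfl | hx)
        · exact hv
        · exact (hsub' x hx).2
      · rcases hx with rfl | hx
        · rcases (hmem t).1 ⟨ht, htx⟩ with rfl | rfl
          · exact ⟨x₀, Or.inr hx₀, (hsub' _ hx₀).1, hrx₀⟩
          · exact ⟨x₁, Or.inr hx₁, (hsub' _ hx₁).1, hsx₁⟩
        · by_cases htrs : t = r ∨ t = s
          · exact ⟨v, Or.inl rfl, (hsub' x hx).1.symm, ((hmem t).2 htrs).2⟩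
          · push Not at htrs
            obtain ⟨w, hw, h1⟩ := key t ht htrs.1 htrs.2 x hx htx
            exact ⟨w, Or.inr hw, h1⟩
      · rintro x (rfl | hx) hc
        · exact absurd hc hh
        · exact hx
    · -- one of the rows vanishes on `S`, so that the other one agrees there with the sum
      refine ⟨S, ⟨fun x hx => (hsub' x hx).2, fun t ht x hx htx => ?_⟩, subset_rfl,
        fun _ hx _ => hx⟩
      have hzero : (∀ x ∈ S, H.mat r x = 0) ∨ ∀ x ∈ S, H.mat s x = 0 := by
        by_contra! hcon
        exact hex hcon
      by_cases htr : t = r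
      · subst htr
        rcases hzero with h0 | h0
        · exact absurd (h0 x hx) htx
        · obtain ⟨w, hw, hwx, hne⟩ := keyr x hx (by simpa [h0 x hx] using htx)
          exact ⟨w, hw, hwx, by simpa [h0 w hw] using hne⟩
      · by_cases hts : t = s
        · subst hts
          rcases hzero with h0 | h0
          · obtain ⟨w, hw, hwx, hne⟩ := keyr x hx (by simpa [h0 x hx] using htx)
            exact ⟨w, hw, hwx, by simpa [h0 w hw] using hne⟩
          · exact absurd (h0 x hx) htx
        · exact key t ht htr hts x hx htx

lemma exists_isStoppingSet_of_reflTransGen {isCVN : V → Prop} {H H' : PCM V C}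
    (h : Relation.ReflTransGen (PruneStep isCVN) H H') {S : Set V} (hS : H'.IsStoppingSet S) :
    ∃ S', H.IsStoppingSet S' ∧ S ⊆ S' ∧ ∀ v ∈ S', isCVN v → v ∈ S := by
  induction h generalizing S with
  | refl => exact ⟨S, hS, subset_rfl, fun _ h _ => h⟩
  | tail _ hstep ih =>
    obtain ⟨S₁, h₁, hsub₁, hc₁⟩ := hstep.exists_isStoppingSet hS
    obtain ⟨S₂, h₂, hsub₂, hc₂⟩ := ih h₁
    exact ⟨S₂, h₂, hsub₁.trans hsub₂, fun v hv hc => hc₁ v (hc₂ v hv hc) hc⟩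

lemma TriState.refs_subset_of_reflTransGen {H : PCM V C} {D : Finset V} {s : TriState V C}
    (h : Relation.ReflTransGen (TriStep H D) TriState.init s) : s.refs ⊆ H.cols \ D := by
  induction h with
  | refl => simp [TriState.init]
  | tail _ hstep ih =>
    cases hstep with
    | extend r v h => exact ih
    | choose T hT hsub h =>
      refine Finset.union_subset ih (hsub.trans fun x hx => ?_)
      simp only [TriState.remaining, Finset.mem_sdiff, Finset.mem_union] at hx ⊢
      tauto

/-- Reference variables are used only if belief propagation gets stuck. -/
lemma IsDecoderRun.exists_undecoded {H : PCM V C} {obs : V → Option (ZMod 2)} {nr ne : ℕ}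
    (h : IsDecoderRun H obs nr ne) (hnr : nr ≠ 0) : (H.cols \ bpDecoded H obs).Nonempty := by
  obtain ⟨s, hs, -, hcard, -⟩ := h
  refine Finset.Nonempty.mono (TriState.refs_subset_of_reflTransGen hs) ?_
  rw [← Finset.card_ne_zero, hcard]
  exact hnr

lemma IsDecoderRun.le_card [Fintype V] [Fintype C] {H : PCM V C} {obs : V → Option (ZMod 2)}
    {nr ne : ℕ} (h : IsDecoderRun H obs nr ne) : nr ≤ Fintype.card V ∧ ne ≤ Fintype.card C := by
  obtain ⟨s, -, -, rfl, rfl⟩ := h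
  exact ⟨Finset.card_le_univ _, Finset.card_le_univ _⟩

end stopping

/-! ### Belief propagation and successive cancellation on the factor graph -/

/-- One polarization step on erasure indicators: from two copies of a channel, the bit channel `0`
is erased if one of the copies is, the bit channel `1` if both are. -/
def combineErasures (b : Fin 2) (x y : Bool) : Bool := if b = 0 then x || y else x && y

/-- Whether successive cancellation decoding (with correct past decisions) finds the input with
index `i` erased, given the erasures `e` of the nodes of the last layer of the factor graph. The
most significant bit of `i` belongs to the polarization step next to the channel. -/
def scErased : (n : ℕ) → (Idx n → Bool) → Idx n → Bool
  | 0, e, i => e i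
  | n + 1, e, i =>
    scErased n (fun j => combineErasures (i 0) (e (Fin.cons 0 j)) (e (Fin.cons 1 j))) (Fin.tail i)

/-- The condition that a set of nodes of the factor graph, given as a predicate on layers and
positions, is a stopping set: no butterfly equation has exactly one of its variables in the set. -/
structure IsButterflyStopping {n : ℕ} (S : Fin (n + 1) → Idx n → Prop) : Prop where
  copy : ∀ (l : Fin n) (c : Idx n), c l.rev = 1 → (S l.succ c ↔ S l.castSucc c)
  sum_out : ∀ (l : Fin n) (c : Idx n), c l.rev = 0 → S l.succ c →
    S l.castSucc c ∨ S l.castSucc (Function.update c l.rev 1)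
  sum_fst : ∀ (l : Fin n) (c : Idx n), c l.rev = 0 → S l.castSucc c →
    S l.succ c ∨ S l.castSucc (Function.update c l.rev 1)
  sum_snd : ∀ (l : Fin n) (c : Idx n), c l.rev = 0 →
    S l.castSucc (Function.update c l.rev 1) → S l.succ c ∨ S l.castSucc c

/-- The layers below the last one split into two smaller factor graphs, according to the most
significant bit of the position. -/
lemma IsButterflyStopping.half {n : ℕ} {S : Fin (n + 2) → Idx (n + 1) → Prop}
    (hS : IsButterflyStopping S) (b : Fin 2) :
    IsButterflyStopping fun (l : Fin (n + 1)) (j : Idx n) => S l.castSucc (Fin.cons b j) := by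
  have hrev : ∀ (l : Fin n) (c : Idx n),
      (Fin.cons b c : Idx (n + 1)) l.castSucc.rev = c l.rev := fun l c => by
    rw [Fin.rev_castSucc, Fin.cons_succ]
  have hupd : ∀ (l : Fin n) (c : Idx n),
      Function.update (Fin.cons b c : Idx (n + 1)) l.castSucc.rev 1 =
        Fin.cons b (Function.update c l.rev 1) := fun l c => by
    rw [Fin.rev_castSucc, Fin.cons_update]
  constructor
  · intro l c h
    have := hS.copy l.castSucc (Fin.cons b c) (by rw [hrev, h])
    rwa [Fin.succ_castSucc] at this
  · intro l c h
    have := hS.sum_out l.castSucc (Fin.cons b c) (by rw [hrev, h])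
    rwa [Fin.succ_castSucc, hupd] at this
  · intro l c h
    have := hS.sum_fst l.castSucc (Fin.cons b c) (by rw [hrev, h])
    rwa [Fin.succ_castSucc, hupd] at this
  · intro l c h
    have := hS.sum_snd l.castSucc (Fin.cons b c) (by rw [hrev, h])
    rwa [Fin.succ_castSucc, hupd] at this

/-- Belief propagation is at least as good as successive cancellation: a nonempty stopping set with
only erased nodes in the last layer contains an input that is erased under successive
cancellation. The bits of its index are found from the most significant one on: the half
of the graph with bit `0` is entered if it meets the stopping set. -/
lemma IsButterflyStopping.exists_scErased {n : ℕ} {S : Fin (n + 1) → Idx n → Prop}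
    (hS : IsButterflyStopping S) (hne : ∃ l j, S l j) {e : Idx n → Bool}
    (he : ∀ j, S (Fin.last n) j → e j = true) : ∃ i, S 0 i ∧ scErased n e i = true := by
  induction n with
  | zero =>
    obtain ⟨l, j, h⟩ := hne
    obtain rfl : l = 0 := Fin.ext (by omega)
    exact ⟨j, h, he j h⟩
  | succ n ih =>
    have hcons : ∀ j : Idx n, Function.update (Fin.cons 0 j : Idx (n + 1)) 0 1 = Fin.cons 1 j :=
      fun j => Fin.update_cons_zero _ _ _
    have hrev : (Fin.last n).rev = 0 := Fin.rev_last n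
    have hcopy : ∀ j : Idx n, S (Fin.last _) (Fin.cons 1 j) ↔
        S (Fin.last n).castSucc (Fin.cons 1 j) := fun j => by
      simpa using hS.copy (Fin.last n) (Fin.cons 1 j) (by rw [hrev, Fin.cons_zero])
    have hout : ∀ j : Idx n, S (Fin.last _) (Fin.cons 0 j) →
        S (Fin.last n).castSucc (Fin.cons 0 j) ∨ S (Fin.last n).castSucc (Fin.cons 1 j) := by
      intro j
      simpa [hrev, hcons] using hS.sum_out (Fin.last n) (Fin.cons 0 j) (by rw [hrev, Fin.cons_zero])
    have hfst : ∀ j : Idx n, S (Fin.last n).castSucc (Fin.cons 0 j) →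
        S (Fin.last _) (Fin.cons 0 j) ∨ S (Fin.last n).castSucc (Fin.cons 1 j) := by
      intro j
      simpa [hrev, hcons] using hS.sum_fst (Fin.last n) (Fin.cons 0 j) (by rw [hrev, Fin.cons_zero])
    have hsnd : ∀ j : Idx n, S (Fin.last n).castSucc (Fin.cons 1 j) →
        S (Fin.last _) (Fin.cons 0 j) ∨ S (Fin.last n).castSucc (Fin.cons 0 j) := by
      intro j
      simpa [hrev, hcons] using hS.sum_snd (Fin.last n) (Fin.cons 0 j) (by rw [hrev, Fin.cons_zero])
    by_cases h0 : ∃ (l : Fin (n + 1)) (j : Idx n), S l.castSucc (Fin.cons 0 j)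
    · obtain ⟨i, hi, her⟩ := ih (hS.half 0) h0
        (e := fun j => combineErasures 0 (e (Fin.cons 0 j)) (e (Fin.cons 1 j))) fun j hj => by
          simp only [combineErasures, if_true, Bool.or_eq_true]
          rcases hfst j hj with h | h
          · exact Or.inl (he _ h)
          · exact Or.inr (he _ ((hcopy j).2 h))
      exact ⟨Fin.cons 0 i, hi, by simpa [scErased] using her⟩
    · push Not at h0
      have h1 : ∃ (l : Fin (n + 1)) (j : Idx n), S l.castSucc (Fin.cons 1 j) := by
        obtain ⟨l, i, hli⟩ := hne
        obtain ⟨b, j, rfl⟩ : ∃ (b : Fin 2) (j : Idx n), i = Fin.cons b j :=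
          ⟨i 0, Fin.tail i, (Fin.cons_self_tail i).symm⟩
        induction l using Fin.lastCases with
        | last =>
          fin_cases b
          · exact ⟨Fin.last n, j, (hout j hli).resolve_left (h0 _ _)⟩
          · exact ⟨Fin.last n, j, (hcopy j).1 hli⟩
        | cast l =>
          fin_cases b
          · exact absurd hli (h0 l j)
          · exact ⟨l, j, hli⟩
      obtain ⟨i, hi, her⟩ := ih (hS.half 1) h1
        (e := fun j => combineErasures 1 (e (Fin.cons 0 j)) (e (Fin.cons 1 j))) fun j hj => by
          simp only [combineErasures, one_ne_zero, if_false, Bool.and_eq_true]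
          exact ⟨he _ ((hsnd j hj).resolve_right (h0 _ _)), he _ ((hcopy j).2 hj)⟩
      exact ⟨Fin.cons 1 i, hi, by simpa [scErased] using her⟩

lemma isButterflyStopping_of_isStoppingSet {n : ℕ} {A : Finset (Idx n)} {S : Set (VarNode n)}
    (hS : (unfrozenPCM A).IsStoppingSet S) : IsButterflyStopping fun l j => (l, j) ∈ S := by
  obtain ⟨-, hS_stop⟩ := hS
  have hmat : ∀ (l : Fin n) (c : Idx n) (v : VarNode n), (unfrozenPCM A).mat (l, c) v ≠ 0 ↔
      (v = (l.succ, c) ∨ v = (l.castSucc, c) ∨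
        (c l.rev = 0 ∧ v = (l.castSucc, Function.update c l.rev 1))) := by
    rintro l c ⟨k, j⟩
    simp only [unfrozenPCM, fgMatrix, Matrix.of_apply, ne_eq, ite_eq_right_iff, one_ne_zero,
      imp_false, not_not, Prod.mk.injEq]
    tauto
  have hne : ∀ l : Fin n, l.succ ≠ l.castSucc := fun l => (Fin.castSucc_lt_succ).ne'
  have key : ∀ (l : Fin n) (c : Idx n), ∀ v ∈ S, (v = (l.succ, c) ∨ v = (l.castSucc, c) ∨
        (c l.rev = 0 ∧ v = (l.castSucc, Function.update c l.rev 1))) → ∃ w ∈ S, w ≠ v ∧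
        (w = (l.succ, c) ∨ w = (l.castSucc, c) ∨
        (c l.rev = 0 ∧ w = (l.castSucc, Function.update c l.rev 1))) := by
    intro l c v hv h
    obtain ⟨w, hw, hwv, h'⟩ := hS_stop (l, c) (Finset.mem_univ _) v hv ((hmat l c v).2 h)
    exact ⟨w, hw, hwv, (hmat l c w).1 h'⟩
  constructor
  · intro l c h
    constructor
    · intro hm
      obtain ⟨w, hw, hwv, h1 | h1 | h1⟩ := key l c _ hm (Or.inl rfl)
      · exact absurd h1 hwv
      · exact h1 ▸ hw
      · simp [h] at h1
    · intro hm
      obtain ⟨w, hw, hwv, h1 | h1 | h1⟩ := key l c _ hm (Or.inr (Or.inl rfl))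
      · exact h1 ▸ hw
      · exact absurd h1 hwv
      · simp [h] at h1
  · intro l c h hm
    obtain ⟨w, hw, hwv, h1 | h1 | h1⟩ := key l c _ hm (Or.inl rfl)
    · exact absurd h1 hwv
    · exact Or.inl (h1 ▸ hw)
    · exact Or.inr (h1.2 ▸ hw)
  · intro l c h hm
    obtain ⟨w, hw, hwv, h1 | h1 | h1⟩ := key l c _ hm (Or.inr (Or.inl rfl))
    · exact Or.inl (h1 ▸ hw)
    · exact absurd h1 hwv
    · exact Or.inr (h1.2 ▸ hw)
  · intro l c h hm
    obtain ⟨w, hw, hwv, h1 | h1 | h1⟩ := key l c _ hm (Or.inr (Or.inr ⟨h, rfl⟩))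
    · exact Or.inl (h1 ▸ hw)
    · exact Or.inr (h1 ▸ hw)
    · exact absurd h1.2 hwv

/-- If reference variables are needed, then successive cancellation finds some information bit
erased. -/
lemma IsDecoderRun.exists_scErased {n : ℕ} {A : Finset (Idx n)}
    {H : PCM (VarNode n) (CheckNode n)} (hH : IsPrunedPCM A H) {y : Idx n → Option (ZMod 2)}
    {nr ne : ℕ} (h : IsDecoderRun H (channelInfo y) nr ne) (hnr : nr ≠ 0) :
    ∃ i ∈ A, scErased n (fun j => (y (bitRev j)).isNone) i = true := by
  obtain ⟨S, hS, hsub, hc⟩ :=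
    exists_isStoppingSet_of_reflTransGen hH.1 (isStoppingSet_undecoded H (channelInfo y))
  obtain ⟨v, hv⟩ := h.exists_undecoded hnr
  obtain ⟨i, hi, her⟩ := (isButterflyStopping_of_isStoppingSet hS).exists_scErased
    ⟨v.1, v.2, hsub hv⟩ (e := fun j => (y (bitRev j)).isNone) fun j hj => by
      have := obs_eq_none_of_undecoded (Finset.mem_coe.1 (hc _ hj rfl))
      simpa [channelInfo] using this
  refine ⟨i, ?_, her⟩
  have := hS.1 hi
  simpa [unfrozenPCM] using this

/-! ### Erasure probabilities of the bit channels -/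

/-- The probability of an erasure indicator with erasure probability `z`. -/
def erasureWeight (z : ℝ) (x : Bool) : ℝ := if x then z else 1 - z

/-- The erasure probability of the worse (`b = 0`) or better (`b = 1`) transform of a BEC with erasure
probability `z`. -/
def polarStep (b : Fin 2) (z : ℝ) : ℝ := if b = 0 then 2 * z - z ^ 2 else z ^ 2

/-- Applying a map to each of finitely many independent variables: the images are independent, and
distributed according to the images of the laws. -/
lemma sum_prod_mul_comp {ι α β : Type*} [Fintype ι] [DecidableEq ι] [Fintype α]
    [Fintype β] [DecidableEq β] (w : ι → α → ℝ) (φ : α → β) (g : (ι → β) → ℝ) :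
    ∑ f : ι → α, (∏ j, w j (f j)) * g (fun j => φ (f j)) =
      ∑ h : ι → β, (∏ j, ∑ a with φ a = h j, w j a) * g h := by
  classical
  rw [← Finset.sum_fiberwise Finset.univ (fun (f : ι → α) j => φ (f j))]
  refine Finset.sum_congr rfl fun h _ => ?_
  rw [Finset.prod_univ_sum, Finset.sum_mul]
  refine Finset.sum_congr ?_ fun f hf => ?_
  · ext f
    simp [funext_iff]
  · have : (fun j => φ (f j)) = h := by
      funext j
      simpa using Fintype.mem_piFinset.1 hf j
    rw [this]

/-- Bit patterns of length `2 ^ (n + 1)` as pairs of patterns of length `2 ^ n`, according to the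
first bit of the position. -/
def splitFirst (n : ℕ) : (Idx (n + 1) → Bool) ≃ (Idx n → Bool × Bool) where
  toFun e j := (e (Fin.cons 0 j), e (Fin.cons 1 j))
  invFun f i := if i 0 = 0 then (f (Fin.tail i)).1 else (f (Fin.tail i)).2
  left_inv e := by
    funext i
    obtain ⟨b, j, rfl⟩ : ∃ (b : Fin 2) (j : Idx n), i = Fin.cons b j :=
      ⟨i 0, Fin.tail i, (Fin.cons_self_tail i).symm⟩
    fin_cases b <;> simp
  right_inv f := by
    funext j
    simp

lemma sum_idx_succ {M : Type*} [AddCommMonoid M] {n : ℕ} (g : Idx (n + 1) → M) :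
    ∑ i, g i = ∑ j : Idx n, g (Fin.cons 0 j) + ∑ j : Idx n, g (Fin.cons 1 j) := by
  rw [← (Fin.consEquiv fun _ : Fin (n + 1) => Fin 2).sum_comp, Fintype.sum_prod_type,
    Fin.sum_univ_two]
  rfl

lemma prod_idx_succ {n : ℕ} (g : Idx (n + 1) → ℝ) :
    ∏ i, g i = ∏ j : Idx n, g (Fin.cons 0 j) * g (Fin.cons 1 j) := by
  rw [← (Fin.consEquiv fun _ : Fin (n + 1) => Fin 2).prod_comp, Fintype.prod_prod_type,
    Fin.prod_univ_two, ← Finset.prod_mul_distrib]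
  rfl

/-- The Bhattacharyya parameters can also be computed starting from the most significant bit. -/
lemma bhattacharyya_succ (ε : ℝ) (n : ℕ) (i : Idx (n + 1)) :
    bhattacharyya ε (n + 1) i = bhattacharyya (polarStep (i 0) ε) n (Fin.tail i) := by
  induction n with
  | zero => simp [bhattacharyya, polarStep]
  | succ n ih =>
    rw [bhattacharyya, ih, bhattacharyya]
    rfl

/-- The Bhattacharyya parameter is the probability that successive cancellation finds the bit
erased, if the nodes are erased independently with probability `z`. -/
lemma sum_erasureWeight_scErased (z : ℝ) (n : ℕ) (i : Idx n) :
    ∑ e : Idx n → Bool, (∏ j, erasureWeight z (e j)) * (if scErased n e i then 1 else 0) =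
      bhattacharyya z n i := by
  induction n generalizing z with
  | zero =>
    rw [← (Equiv.funUnique (Idx 0) Bool).symm.sum_comp]
    simp [erasureWeight, scErased, bhattacharyya, Equiv.funUnique]
  | succ n ih =>
    rw [bhattacharyya_succ, ← ih, ← (splitFirst n).symm.sum_comp]
    have hstep : ∀ x : Bool,
        ∑ a : Bool × Bool with combineErasures (i 0) a.1 a.2 = x,
          erasureWeight z a.1 * erasureWeight z a.2 = erasureWeight (polarStep (i 0) z) x := by
      intro x
      rw [Finset.sum_filter, Fintype.sum_prod_type]
      by_cases h : i 0 = 0 <;> cases x <;>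
        simp [h, combineErasures, erasureWeight, polarStep] <;> ring
    have := sum_prod_mul_comp
      (fun (_ : Idx n) (a : Bool × Bool) => erasureWeight z a.1 * erasureWeight z a.2)
      (fun a => combineErasures (i 0) a.1 a.2)
      (fun e => if scErased n e (Fin.tail i) then (1 : ℝ) else 0)
    simp only [hstep] at this
    rw [← this]
    refine Finset.sum_congr rfl fun f _ => ?_
    rw [prod_idx_succ]
    simp [splitFirst, scErased]

lemma sum_becProb_filter (ε : ℝ) (x : ZMod 2) (b : Bool) :
    ∑ a : Option (ZMod 2) with a.isNone = b, becProb ε x a = erasureWeight ε b := by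
  rw [Finset.sum_filter, Fintype.sum_option]
  cases b <;> simp [becProb, erasureWeight]

/-- Whatever codeword is sent over the BEC, successive cancellation finds a bit erased with
probability its Bhattacharyya parameter. -/
lemma sum_becProb_scErased (ε : ℝ) {n : ℕ} (x : Idx n → ZMod 2) (i : Idx n) :
    ∑ b : Idx n → Option (ZMod 2), (∏ j, becProb ε (x j) (b j)) *
      (if scErased n (fun j => (b (bitRev j)).isNone) i then 1 else 0) = bhattacharyya ε n i := by
  rw [← sum_erasureWeight_scErased, ← (Equiv.arrowCongr bitRev (Equiv.refl _)).sum_comp]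
  have := sum_prod_mul_comp (fun (j : Idx n) (a : Option (ZMod 2)) => becProb ε (x (bitRev j)) a)
    Option.isNone (fun e => if scErased n e i then (1 : ℝ) else 0)
  simp only [sum_becProb_filter] at this
  rw [← this]
  refine Finset.sum_congr rfl fun f _ => ?_
  rw [← Equiv.prod_comp (bitRev (n := n))]
  simp

section transmission

variable {n : ℕ} {ε : ℝ} {A : Finset (Idx n)} {Ω : Type*} [MeasurableSpace Ω] {P : Measure Ω}
  {u : Ω → Idx n → ZMod 2} {y : Ω → Idx n → Option (ZMod 2)}

/-- A union bound. -/
lemma IsTransmission.measureReal_exists_scErased_le [IsProbabilityMeasure P]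
    (h : IsTransmission ε A P u y) :
    P.real {ω | ∃ i ∈ A, scErased n (fun j => (y ω (bitRev j)).isNone) i = true} ≤
      ∑ i ∈ A, bhattacharyya ε n i := by
  classical
  have hrw : {ω | ∃ i ∈ A, scErased n (fun j => (y ω (bitRev j)).isNone) i = true} =
      ⋃ i ∈ A, {ω | scErased n (fun j => (y ω (bitRev j)).isNone) i = true} := by
    ext ω; simp
  rw [hrw]
  refine (measureReal_biUnion_finset_le _ _).trans (Finset.sum_le_sum fun i _ => le_of_eq ?_)
  -- the event is the disjoint union of the events `u = a`, `y = b` over all `a` and suitable `b`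
  have hset : {ω | scErased n (fun j => (y ω (bitRev j)).isNone) i = true} =
      ⋃ x ∈ (Finset.univ.filter fun x : (Idx n → ZMod 2) × (Idx n → Option (ZMod 2)) =>
        scErased n (fun j => (x.2 (bitRev j)).isNone) i = true), {ω | u ω = x.1 ∧ y ω = x.2} := by
    ext ω
    simp
  have hmeas : ∀ a b, MeasurableSet {ω | u ω = a ∧ y ω = b} := fun a b =>
    (h.measurable_u a).inter (h.measurable_y b)
  have htot : ∑ a, P.real {ω | u ω = a} = 1 := by
    rw [← measureReal_biUnion_finset _ fun a _ => h.measurable_u a]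
    · have : (⋃ a ∈ (Finset.univ : Finset (Idx n → ZMod 2)), {ω | u ω = a}) = Set.univ := by
        ext ω; simp
      rw [this, probReal_univ]
    · intro a _ b _ hab
      exact Set.disjoint_left.2 fun ω (ha : u ω = a) (hb : u ω = b) => hab (ha.symm.trans hb)
  rw [hset, measureReal_biUnion_finset _ fun x _ => hmeas x.1 x.2]
  · simp only [h.law]
    rw [Finset.sum_filter, Fintype.sum_prod_type]
    calc _ = ∑ a, P.real {ω | u ω = a} * ∑ b : Idx n → Option (ZMod 2),
          (∏ j, becProb ε (encode a j) (b j)) *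
            (if scErased n (fun j => (b (bitRev j)).isNone) i then 1 else 0) := by
          refine Finset.sum_congr rfl fun a _ => ?_
          rw [Finset.mul_sum]
          refine Finset.sum_congr rfl fun b _ => ?_
          split_ifs <;> simp
      _ = bhattacharyya ε n i := by
          simp only [sum_becProb_scErased]
          rw [← Finset.sum_mul, htot, one_mul]
  · intro a _ b _ hab
    refine Set.disjoint_left.2 fun ω ha hb => hab ?_
    exact Prod.ext (ha.1.symm.trans hb.1) (ha.2.symm.trans hb.2)

end transmission

/-! ### Polarization of the binary erasure channel -/

/-- The mean of `g` over the erasure probabilities of the `2 ^ n` bit channels obtained from a BEC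
with erasure probability `z` by `n` polarization steps. -/
noncomputable def polarMean : ℕ → (ℝ → ℝ) → ℝ → ℝ
  | 0, g, z => g z
  | n + 1, g, z => (polarMean n g (2 * z - z ^ 2) + polarMean n g (z ^ 2)) / 2

lemma sum_bhattacharyya (g : ℝ → ℝ) (n : ℕ) (z : ℝ) :
    ∑ i : Idx n, g (bhattacharyya z n i) = 2 ^ n * polarMean n g z := by
  induction n generalizing z with
  | zero => simp [bhattacharyya, polarMean]
  | succ n ih =>
    rw [sum_idx_succ]
    simp only [bhattacharyya_succ, Fin.cons_zero, Fin.tail_cons, ih, polarMean, polarStep]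
    simp only [if_true, one_ne_zero, if_false]
    ring

lemma polarMean_add (m k : ℕ) (g : ℝ → ℝ) (z : ℝ) :
    polarMean (m + k) g z = polarMean m (polarMean k g) z := by
  induction m generalizing z with
  | zero => simp [polarMean]
  | succ m ih => rw [Nat.succ_add]; simp only [polarMean, ih]

lemma worse_mem_Icc {z : ℝ} (hz : z ∈ Set.Icc (0 : ℝ) 1) :
    2 * z - z ^ 2 ∈ Set.Icc (0 : ℝ) 1 := by
  obtain ⟨h0, h1⟩ := hz
  constructor <;> nlinarith

lemma better_mem_Icc {z : ℝ} (hz : z ∈ Set.Icc (0 : ℝ) 1) : z ^ 2 ∈ Set.Icc (0 : ℝ) 1 := by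
  obtain ⟨h0, h1⟩ := hz
  constructor <;> nlinarith

lemma polarMean_mono {f g : ℝ → ℝ} (h : ∀ z ∈ Set.Icc (0 : ℝ) 1, f z ≤ g z) (n : ℕ) :
    ∀ z ∈ Set.Icc (0 : ℝ) 1, polarMean n f z ≤ polarMean n g z := by
  induction n with
  | zero => exact h
  | succ n ih =>
    intro z hz
    have := ih _ (worse_mem_Icc hz)
    have := ih _ (better_mem_Icc hz)
    simp only [polarMean]
    linarith

lemma polarMean_linear (f : ℝ → ℝ) (a b : ℝ) (n : ℕ) (z : ℝ) :
    polarMean n (fun x => x + a * f x + b) z = z + a * polarMean n f z + b := by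
  induction n generalizing z with
  | zero => rfl
  | succ n ih =>
    simp only [polarMean, ih]
    ring

lemma polarMean_const_mul (f : ℝ → ℝ) (a : ℝ) (n : ℕ) (z : ℝ) :
    polarMean n (fun x => a * f x) z = a * polarMean n f z := by
  induction n generalizing z with
  | zero => rfl
  | succ n ih =>
    simp only [polarMean, ih]
    ring

lemma polarMean_const (b : ℝ) (n : ℕ) (z : ℝ) : polarMean n (fun _ => b) z = b := by
  induction n generalizing z with
  | zero => rfl
  | succ n ih =>
    simp only [polarMean, ih]
    ring

/-- One polarization step shrinks the mean of `√(z (1 - z))` by the factor `√3 / 2`. -/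
lemma sqrt_mul_one_sub_step {z : ℝ} (hz : z ∈ Set.Icc (0 : ℝ) 1) :
    (√((2 * z - z ^ 2) * (1 - (2 * z - z ^ 2))) + √(z ^ 2 * (1 - z ^ 2))) / 2 ≤
      √(3 / 4) * √(z * (1 - z)) := by
  obtain ⟨h0, h1⟩ := hz
  have ht : 0 ≤ z * (1 - z) := mul_nonneg h0 (by linarith)
  have e1 : (2 * z - z ^ 2) * (1 - (2 * z - z ^ 2)) = ((1 - z) * (2 - z)) * (z * (1 - z)) := by
    ring
  have e2 : z ^ 2 * (1 - z ^ 2) = (z * (1 + z)) * (z * (1 - z)) := by ring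
  have hA : 0 ≤ (1 - z) * (2 - z) := mul_nonneg (by linarith) (by linarith)
  have hB : 0 ≤ z * (1 + z) := mul_nonneg h0 (by linarith)
  rw [e1, e2, Real.sqrt_mul hA, Real.sqrt_mul hB, ← add_mul, mul_div_right_comm]
  refine mul_le_mul_of_nonneg_right ?_ (Real.sqrt_nonneg _)
  apply Real.le_sqrt_of_sq_le
  set a := √((1 - z) * (2 - z)) with ha
  set b := √(z * (1 + z)) with hb
  have sa : a ^ 2 = (1 - z) * (2 - z) := Real.sq_sqrt hA
  have sb : b ^ 2 = z * (1 + z) := Real.sq_sqrt hB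
  -- with `t = z (1 - z) ≤ 1 / 4`, the claim is `2 √(t (2 + t)) ≤ 1 + 2 t`
  have hab : 2 * (a * b) ≤ 1 + 2 * (z * (1 - z)) := by
    apply le_of_sq_le_sq _ (by linarith)
    have : (2 * (a * b)) ^ 2 = 4 * (a ^ 2 * b ^ 2) := by ring
    rw [this, sa, sb]
    nlinarith [sq_nonneg (1 - 2 * z)]
  nlinarith

lemma polarMean_sqrt_le (n : ℕ) {z : ℝ} (hz : z ∈ Set.Icc (0 : ℝ) 1) :
    polarMean n (fun x => √(x * (1 - x))) z ≤ √(3 / 4) ^ n := by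
  suffices h : polarMean n (fun x => √(x * (1 - x))) z ≤ √(3 / 4) ^ n * √(z * (1 - z)) by
    refine h.trans (mul_le_of_le_one_right (by positivity) ?_)
    rw [Real.sqrt_le_one]
    obtain ⟨h0, h1⟩ := hz
    nlinarith
  induction n generalizing z with
  | zero => simp [polarMean]
  | succ n ih =>
    have h1 := ih (worse_mem_Icc hz)
    have h2 := ih (better_mem_Icc hz)
    have h3 := mul_le_mul_of_nonneg_left (sqrt_mul_one_sub_step hz)
      (pow_nonneg (Real.sqrt_nonneg (3 / 4)) n)
    simp only [polarMean]
    rw [pow_succ (√(3 / 4))]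
    linarith

/-- As long as the erasure probabilities stay small, the mean of a small power of them shrinks by
a factor close to `1 / 2` in each polarization step. -/
lemma polarMean_rpow_le {γ z₀ : ℝ} (hγ : 0 < γ) (h2 : (2 : ℝ) ^ γ ≤ 11 / 10)
    (hz₀ : z₀ ^ γ ≤ 1 / 10) (k : ℕ) {z : ℝ} (hz : z ∈ Set.Icc (0 : ℝ) 1)
    (hsmall : 2 ^ k * z ≤ z₀) :
    polarMean k (fun x => x ^ γ) z ≤ (3 / 5) ^ k * z ^ γ := by
  induction k generalizing z with
  | zero => simp [polarMean]
  | succ k ih =>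
    obtain ⟨h0, h1⟩ := hz
    have hk : (1 : ℝ) ≤ 2 ^ k := one_le_pow₀ (by norm_num)
    rw [pow_succ] at hsmall
    have i1 := ih (worse_mem_Icc ⟨h0, h1⟩) (by nlinarith [sq_nonneg z])
    have i2 := ih (better_mem_Icc ⟨h0, h1⟩) (by
      have : z ^ 2 ≤ 2 * z := by nlinarith
      nlinarith [mul_le_mul_of_nonneg_left this (by positivity : (0 : ℝ) ≤ 2 ^ k)])
    have hzz : z ≤ z₀ := by nlinarith
    have hzγ : z ^ γ ≤ 1 / 10 := (Real.rpow_le_rpow h0 hzz hγ.le).trans hz₀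
    have hpos : 0 ≤ z ^ γ := Real.rpow_nonneg h0 _
    have j1 : (2 * z - z ^ 2) ^ γ ≤ 11 / 10 * z ^ γ := by
      calc (2 * z - z ^ 2) ^ γ ≤ (2 * z) ^ γ :=
            Real.rpow_le_rpow (worse_mem_Icc ⟨h0, h1⟩).1 (by nlinarith [sq_nonneg z]) hγ.le
        _ = 2 ^ γ * z ^ γ := Real.mul_rpow (by norm_num) h0
        _ ≤ _ := mul_le_mul_of_nonneg_right h2 hpos
    have j2 : (z ^ 2) ^ γ ≤ 1 / 10 * z ^ γ := by
      rw [pow_two, Real.mul_rpow h0 h0]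
      exact mul_le_mul_of_nonneg_right hzγ hpos
    have hc : (0 : ℝ) ≤ (3 / 5) ^ k := by positivity
    have l1 := mul_le_mul_of_nonneg_left j1 hc
    have l2 := mul_le_mul_of_nonneg_left j2 hc
    simp only [polarMean]
    rw [pow_succ (3 / 5 : ℝ)]
    linarith

/-- A bound for the proportion of bit channels with erasure probability more than `δ`, by means of
`m` steps, after which most bit channels are extremal, followed by `k` steps that improve
the good bit channels. -/
lemma polarMean_indicator_le {γ z₀ a δ : ℝ} (hγ : 0 < γ) (h2 : (2 : ℝ) ^ γ ≤ 11 / 10)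
    (hz₀ : z₀ ^ γ ≤ 1 / 10) (m k : ℕ) (ha : 0 < a) (hak : 2 ^ k * a ≤ z₀) (hδ : 0 < δ)
    {ε : ℝ} (hε : ε ∈ Set.Icc (0 : ℝ) 1) :
    polarMean (m + k) (fun z => if δ < z then 1 else 0) ε ≤
      ε + 1 / √a * √(3 / 4) ^ m + (3 / 5) ^ k * (δ ^ γ)⁻¹ := by
  rw [polarMean_add]
  have hδγ : 0 < δ ^ γ := Real.rpow_pos_of_pos hδ _
  have hbound : ∀ z ∈ Set.Icc (0 : ℝ) 1, polarMean k (fun z => if δ < z then 1 else 0) z ≤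
      z + 1 / √a * √(z * (1 - z)) + (3 / 5) ^ k * (δ ^ γ)⁻¹ := by
    intro z hz
    rcases le_or_gt z a with hza | hza
    · have h1 : polarMean k (fun z => if δ < z then 1 else 0) z ≤
          polarMean k (fun z => (δ ^ γ)⁻¹ * z ^ γ) z := by
        refine polarMean_mono (fun x hx => ?_) k z hz
        have hx0 := Real.rpow_nonneg hx.1 γ
        split_ifs with h
        · rw [inv_mul_eq_div, one_le_div hδγ]
          exact Real.rpow_le_rpow hδ.le h.le hγ.le
        · positivity
      rw [polarMean_const_mul] at h1
      have h3 := polarMean_rpow_le hγ h2 hz₀ k hz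
        ((mul_le_mul_of_nonneg_left hza (by positivity)).trans hak)
      have h4 : (3 / 5 : ℝ) ^ k * z ^ γ ≤ (3 / 5) ^ k :=
        mul_le_of_le_one_right (by positivity) (Real.rpow_le_one hz.1 hz.2 hγ.le)
      have h5 := mul_le_mul_of_nonneg_left (h3.trans h4) (inv_nonneg.2 hδγ.le)
      have h6 : 0 ≤ 1 / √a * √(z * (1 - z)) := by positivity
      have := hz.1
      linarith
    · have h1 : polarMean k (fun z => if δ < z then 1 else 0) z ≤ 1 := by
        refine (polarMean_mono (fun x hx => ?_) k z hz).trans_eq (polarMean_const 1 k z)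
        split_ifs <;> norm_num
      -- `1 - z ≤ √(1 - z) ≤ √(z (1 - z)) / √a` for `a < z ≤ 1`
      have h3 : 1 - z ≤ 1 / √a * √(z * (1 - z)) := by
        rw [one_div, inv_mul_eq_div, ← Real.sqrt_div' _ ha.le]
        apply Real.le_sqrt_of_sq_le
        rw [le_div_iff₀ ha]
        have hz1 : 0 ≤ 1 - z := by linarith [hz.2]
        nlinarith [mul_nonneg hz1 (sub_nonneg.2 hza.le), mul_nonneg hz1 hz1,
          mul_nonneg (mul_nonneg hz1 hz.1) ha.le]
      have : 0 ≤ (3 / 5 : ℝ) ^ k * (δ ^ γ)⁻¹ := by positivity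
      linarith
  refine (polarMean_mono hbound m ε hε).trans ?_
  rw [polarMean_linear (fun z => √(z * (1 - z)))]
  have := mul_le_mul_of_nonneg_left (polarMean_sqrt_le m hε) (by positivity : 0 ≤ 1 / √a)
  linarith

/-- Polarization: for every exponent `c`, asymptotically at most a fraction `ε` of the bit channels
has an erasure probability above `(2 ^ n) ^ (-c)`. -/
lemma eventually_polarMean_indicator_le {ε : ℝ} (hε : ε ∈ Set.Icc (0 : ℝ) 1) {c : ℝ} (hc : 1 ≤ c)
    {η : ℝ} (hη : 0 < η) :
    ∀ᶠ n : ℕ in atTop,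
      polarMean n (fun z => if (2 : ℝ) ^ (-(c * n)) < z then 1 else 0) ε ≤ ε + η := by
  have hc0 : 0 < c := by linarith
  set γ : ℝ := 1 / (10 * c) with hγdef
  have hγ : 0 < γ := by positivity
  have h2 : (2 : ℝ) ^ γ ≤ 11 / 10 := by
    calc (2 : ℝ) ^ γ ≤ 2 ^ (1 / 10 : ℝ) := by
          refine Real.rpow_le_rpow_of_exponent_le (by norm_num) ?_
          rw [hγdef]
          exact one_div_le_one_div_of_le (by norm_num) (by linarith)
      _ ≤ 11 / 10 := by
          rw [one_div, Real.rpow_inv_le_iff_of_pos (by norm_num) (by norm_num) (by norm_num)]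
          norm_num
  set z₀ : ℝ := (1 / 10) ^ (1 / γ) with hz₀def
  have hz₀pos : 0 < z₀ := by positivity
  have hz₀ : z₀ ^ γ ≤ 1 / 10 := by
    rw [hz₀def, ← Real.rpow_mul (by norm_num), one_div_mul_cancel hγ.ne', Real.rpow_one]
  have hk : Tendsto (fun n : ℕ => n / 5) atTop atTop :=
    Nat.tendsto_div_const_atTop (by norm_num)
  have hm : Tendsto (fun n : ℕ => n - n / 5) atTop atTop := by
    refine tendsto_atTop_mono (fun n => ?_) hk
    omega
  -- the three error terms
  have t1 : ∀ᶠ n : ℕ in atTop, (512 / 625 : ℝ) ^ (n / 5) < z₀ :=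
    ((tendsto_pow_atTop_nhds_zero_of_lt_one (by norm_num) (by norm_num)).comp hk).eventually
      (gt_mem_nhds hz₀pos)
  have t2 : ∀ᶠ n : ℕ in atTop, (√(15 / 16) : ℝ) ^ (n - n / 5) < η / 2 :=
    ((tendsto_pow_atTop_nhds_zero_of_lt_one (Real.sqrt_nonneg _)
      (by rw [Real.sqrt_lt' one_pos]; norm_num)).comp hm).eventually (gt_mem_nhds (by positivity))
  have t3 : ∀ᶠ n : ℕ in atTop, (3 / 5 * √2 : ℝ) ^ (n / 5) < η / 4 := by
    refine ((tendsto_pow_atTop_nhds_zero_of_lt_one (by positivity) ?_).comp hk).eventually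
      (gt_mem_nhds (by positivity))
    have : √2 < 3 / 2 := by rw [Real.sqrt_lt' (by norm_num)]; norm_num
    linarith
  filter_upwards [t1, t2, t3] with n h1 h3 h4
  set k := n / 5 with hkdef
  set m := n - k with hmdef
  have hmk : m + k = n := by omega
  have hm4 : 4 * k ≤ m := by omega
  have hn : n ≤ 5 * k + 5 := by omega
  have ha : (0 : ℝ) < (4 / 5) ^ m := by positivity
  have hak : (2 : ℝ) ^ k * (4 / 5) ^ m ≤ z₀ := by
    calc (2 : ℝ) ^ k * (4 / 5) ^ m ≤ 2 ^ k * (4 / 5) ^ (4 * k) := by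
          refine mul_le_mul_of_nonneg_left ?_ (by positivity)
          exact pow_le_pow_of_le_one (by norm_num) (by norm_num) hm4
      _ = (512 / 625) ^ k := by
          rw [pow_mul, ← mul_pow]; norm_num
      _ ≤ z₀ := h1.le
  have hδ : (0 : ℝ) < 2 ^ (-(c * n)) := by positivity
  have := polarMean_indicator_le hγ h2 hz₀ m k ha hak hδ hε
  rw [hmk] at this
  refine this.trans ?_
  have e1 : 1 / √((4 / 5 : ℝ) ^ m) * √(3 / 4) ^ m = √(15 / 16) ^ m := by
    have : √((4 / 5 : ℝ) ^ m) = √(4 / 5) ^ m := by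
      rw [Real.sqrt_eq_iff_mul_self_eq (by positivity) (by positivity), ← mul_pow,
        Real.mul_self_sqrt (by norm_num)]
    rw [this, one_div, ← inv_pow, ← mul_pow, ← Real.sqrt_inv, ← Real.sqrt_mul (by norm_num)]
    norm_num
  have e2 : (((2 : ℝ) ^ (-(c * n))) ^ γ)⁻¹ ≤ 2 * √2 ^ k := by
    rw [← Real.rpow_mul (by norm_num), ← Real.rpow_neg (by norm_num)]
    have : -(-(c * n) * γ) = (n : ℝ) / 10 := by
      rw [hγdef]; field_simp
    rw [this]
    have hn' : (n : ℝ) ≤ 5 * k + 5 := by exact_mod_cast hn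
    calc (2 : ℝ) ^ ((n : ℝ) / 10) ≤ 2 ^ (1 + (1 / 2 : ℝ) * k) :=
          Real.rpow_le_rpow_of_exponent_le (by norm_num) (by linarith)
      _ = 2 * √2 ^ k := by
          rw [Real.rpow_add (by norm_num), Real.rpow_one, Real.rpow_mul (by norm_num),
            Real.rpow_natCast, Real.sqrt_eq_rpow]
  have e3 := mul_le_mul_of_nonneg_left e2 (by positivity : (0 : ℝ) ≤ (3 / 5) ^ k)
  rw [mul_pow] at h4
  rw [e1]
  linarith

/-- If the rate stays below `1 - ε`, then for every exponent `c` all information bits eventually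
have Bhattacharyya parameters at most `(2 ^ n) ^ (-c)`. -/
lemma eventually_forall_bhattacharyya_le {ε R : ℝ} (hε : 0 ≤ ε ∧ ε ≤ 1) (hR : R < 1 - ε)
    {K : ℕ → ℕ} (hK : ∀ᶠ n in atTop, (K n : ℝ) / (2 : ℝ) ^ n ≤ R)
    {A : ∀ n, Finset (Idx n)} (hA : ∀ n, IsInfoSet ε (K n) (A n)) {c : ℝ} (hc : 1 ≤ c) :
    ∀ᶠ n : ℕ in atTop, ∀ i ∈ A n, bhattacharyya ε n i ≤ (2 : ℝ) ^ (-(c * n)) := by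
  have hη : 0 < (1 - ε - R) / 2 := by linarith
  filter_upwards [hK, eventually_polarMean_indicator_le hε hc hη] with n hKn hmean i hi
  by_contra! hbig
  set δ : ℝ := (2 : ℝ) ^ (-(c * n)) with hδ
  have hpow : (0 : ℝ) < 2 ^ n := by positivity
  have hcount : ((Finset.univ.filter fun j : Idx n => δ < bhattacharyya ε n j).card : ℝ) ≤
      2 ^ n * (ε + (1 - ε - R) / 2) := by
    have := sum_bhattacharyya (fun z => if δ < z then (1 : ℝ) else 0) n ε
    rw [Finset.sum_boole] at this
    rw [this]
    exact mul_le_mul_of_nonneg_left hmean hpow.le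
  -- one bad information bit makes all frozen bits bad
  have hsub : (A n)ᶜ ⊆ Finset.univ.filter fun j : Idx n => δ < bhattacharyya ε n j := by
    intro j hj
    exact Finset.mem_filter.2
      ⟨Finset.mem_univ _, hbig.trans_le ((hA n).2 i hi j (Finset.mem_compl.1 hj))⟩
  have h1 : (2 : ℝ) ^ n - K n ≤
      ((Finset.univ.filter fun j : Idx n => δ < bhattacharyya ε n j).card : ℝ) := by
    have h2 : ((A n)ᶜ.card : ℝ) + (A n).card = 2 ^ n := by
      have := Finset.card_compl_add_card (A n)
      simp only [Fintype.card_fun, Fintype.card_fin] at this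
      exact_mod_cast this
    have h3 : ((A n)ᶜ.card : ℝ) ≤ _ := Nat.cast_le.2 (Finset.card_le_card hsub)
    rw [(hA n).1] at h2
    linarith
  rw [div_le_iff₀ hpow] at hKn
  nlinarith

/-! ### The expectation -/

/-- The expectation is at most the largest value times the probability that successive cancellation
fails. -/
lemma integral_decoder_le {ε : ℝ} {n : ℕ} {A : Finset (Idx n)}
    {H : PCM (VarNode n) (CheckNode n)} (hH : IsPrunedPCM A H)
    {Ω : Type*} [MeasurableSpace Ω] {P : Measure Ω} [IsProbabilityMeasure P]
    {u : Ω → Idx n → ZMod 2} {y : Ω → Idx n → Option (ZMod 2)} (hy : IsTransmission ε A P u y)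
    {nr ne : Ω → ℕ} (hnr : Measurable nr) (hne : Measurable ne)
    (hrun : ∀ᵐ ω ∂P, IsDecoderRun H (channelInfo (y ω)) (nr ω) (ne ω))
    {q p : ℝ} (hq : 0 < q) (hp : 0 < p) {w : ℝ} (hw : 0 ≤ w) :
    Integrable (fun ω => w * (nr ω : ℝ) ^ q * (ne ω : ℝ) ^ p) P ∧
      ∫ ω, w * (nr ω : ℝ) ^ q * (ne ω : ℝ) ^ p ∂P ≤
        w * (((n + 1) * 2 ^ n : ℝ) ^ q * ((n * 2 ^ n : ℝ) ^ p)) *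
          ∑ i ∈ A, bhattacharyya ε n i := by
  set M : ℝ := w * (((n + 1) * 2 ^ n : ℝ) ^ q * ((n * 2 ^ n : ℝ) ^ p)) with hM
  have hM0 : 0 ≤ M := by positivity
  set F : Set Ω := {ω | ∃ i ∈ A, scErased n (fun j => (y ω (bitRev j)).isNone) i = true} with hF
  have hFmeas : MeasurableSet F := by
    have : F = ⋃ b ∈ {b : Idx n → Option (ZMod 2) |
        ∃ i ∈ A, scErased n (fun j => (b (bitRev j)).isNone) i = true}, {ω | y ω = b} := by
      ext ω
      simp [hF]
    rw [this]
    exact MeasurableSet.biUnion (Set.to_countable _) fun b _ => hy.measurable_y b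
  have hbound : ∀ᵐ ω ∂P, w * (nr ω : ℝ) ^ q * (ne ω : ℝ) ^ p ≤ F.indicator (fun _ => M) ω := by
    filter_upwards [hrun] with ω hω
    by_cases h0 : nr ω = 0
    · rw [h0, Nat.cast_zero, Real.zero_rpow hq.ne', mul_zero, zero_mul]
      exact Set.indicator_nonneg (fun _ _ => hM0) _
    · rw [Set.indicator_of_mem (show ω ∈ F from hω.exists_scErased hH h0), hM, mul_assoc]
      obtain ⟨h1, h2⟩ := hω.le_card
      simp only [Fintype.card_prod, Fintype.card_fun, Fintype.card_fin] at h1 h2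
      have h1' : (nr ω : ℝ) ≤ (n + 1) * 2 ^ n := by exact_mod_cast h1
      have h2' : (ne ω : ℝ) ≤ n * 2 ^ n := by exact_mod_cast h2
      gcongr
  have hnonneg : ∀ ω, 0 ≤ w * (nr ω : ℝ) ^ q * (ne ω : ℝ) ^ p := fun ω => by positivity
  have hind : Integrable (F.indicator fun _ => M) P := (integrable_const M).indicator hFmeas
  have hint : Integrable (fun ω => w * (nr ω : ℝ) ^ q * (ne ω : ℝ) ^ p) P := by
    have hmeas : Measurable fun ω => w * (nr ω : ℝ) ^ q * (ne ω : ℝ) ^ p :=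
      (((measurable_from_nat (f := fun k : ℕ => (k : ℝ) ^ q)).comp hnr).const_mul w).mul
        ((measurable_from_nat (f := fun k : ℕ => (k : ℝ) ^ p)).comp hne)
    refine hind.mono' hmeas.aestronglyMeasurable ?_
    filter_upwards [hbound] with ω hω
    rwa [Real.norm_of_nonneg (hnonneg ω)]
  refine ⟨hint, (integral_mono_ae hint hind hbound).trans ?_⟩
  rw [integral_indicator_const _ hFmeas, smul_eq_mul, mul_comm]
  exact mul_le_mul_of_nonneg_left hy.measureReal_exists_scErased_le hM0

/-- The bound for the expectation that results from Bhattacharyya parameters `(2 ^ n) ^ (-c)` with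
`c = q + p + 3`. -/
lemma tendsto_expectation_bound (q : ℝ) {p : ℝ} (hp : 0 < p) :
    Tendsto (fun n : ℕ => ((2 : ℝ) ^ n * Real.log ((2 : ℝ) ^ n)) *
      (((n + 1) * 2 ^ n : ℝ) ^ q * ((n * 2 ^ n : ℝ) ^ p)) *
        (2 ^ n * (2 : ℝ) ^ (-((q + p + 3) * n)))) atTop (𝓝 0) := by
  have hpoly : Tendsto (fun n : ℕ => Real.log 2 * (n : ℝ) ^ (1 + p) * ((n : ℝ) + 1) ^ q *
      2 ^ (-(n : ℝ))) atTop (𝓝 0) := by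
    have hlog : 0 < Real.log 2 := Real.log_pos (by norm_num)
    have h1 : Tendsto (fun n : ℕ => Real.log 2 * 2 * (((n : ℝ) + 1) ^ (1 + p + q) *
        Real.exp (-Real.log 2 * ((n : ℝ) + 1)))) atTop (𝓝 0) := by
      have := (tendsto_rpow_mul_exp_neg_mul_atTop_nhds_zero (1 + p + q) (Real.log 2) hlog).comp
        (tendsto_atTop_add_const_right atTop (1 : ℝ) tendsto_natCast_atTop_atTop)
      simpa using this.const_mul (Real.log 2 * 2)
    refine squeeze_zero (fun n => by positivity) (fun n => ?_) h1
    have e1 : Real.exp (-Real.log 2 * ((n : ℝ) + 1)) = 2 ^ (-(n : ℝ)) / 2 := by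
      rw [neg_mul, ← mul_neg, ← Real.rpow_def_of_pos (by norm_num), neg_add, Real.rpow_add
        (by norm_num), Real.rpow_neg_one, div_eq_mul_inv]
    have e2 : (n : ℝ) ^ (1 + p) ≤ ((n : ℝ) + 1) ^ (1 + p) :=
      Real.rpow_le_rpow (by positivity) (by linarith) (by linarith)
    rw [e1, Real.rpow_add (by positivity : (0 : ℝ) < n + 1) (1 + p) q]
    calc _ ≤ Real.log 2 * ((n : ℝ) + 1) ^ (1 + p) * ((n : ℝ) + 1) ^ q * 2 ^ (-(n : ℝ)) := by
          gcongr
      _ = _ := by ring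
  refine hpoly.congr' ?_
  filter_upwards [eventually_gt_atTop 0] with n hn
  have hn' : (0 : ℝ) < n := by exact_mod_cast hn
  have h2 : (0 : ℝ) < 2 ^ n := by positivity
  rw [Real.mul_rpow (by positivity) h2.le, Real.mul_rpow hn'.le h2.le, Real.log_pow,
    Real.rpow_add hn', Real.rpow_one]
  have e : (2 : ℝ) ^ (-(n : ℝ)) =
      2 ^ n * (2 ^ n : ℝ) ^ q * (2 ^ n : ℝ) ^ p * (2 ^ n * (2 : ℝ) ^ (-((q + p + 3) * n))) := by
    rw [← Real.rpow_natCast, ← Real.rpow_mul (by norm_num), ← Real.rpow_mul (by norm_num),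
      ← Real.rpow_add (by norm_num), ← Real.rpow_add (by norm_num), ← Real.rpow_add (by norm_num),
      ← Real.rpow_add (by norm_num)]
    congr 1
    ring
  rw [e]
  ring

end PolarBEC

theorem proposition1
    (ε R : ℝ) (hε : 0 ≤ ε ∧ ε ≤ 1) (hR : R < 1 - ε)
    -- a sequence of polar codes of blocklength `2 ^ n` whose rates are (eventually) at most `R`
    (K : ℕ → ℕ) (hK : ∀ᶠ n in atTop, (K n : ℝ) / (2 : ℝ) ^ n ≤ R)
    (A : ∀ n, Finset (PolarBEC.Idx n)) (hA : ∀ n, PolarBEC.IsInfoSet ε (K n) (A n))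
    -- their pruned parity check matrices
    (H : ∀ n, PolarBEC.PCM (PolarBEC.VarNode n) (PolarBEC.CheckNode n))
    (hH : ∀ n, PolarBEC.IsPrunedPCM (A n) (H n))
    -- transmission over the channel
    {Ω : ℕ → Type*} [∀ n, MeasurableSpace (Ω n)] (P : ∀ n, Measure (Ω n))
    [∀ n, IsProbabilityMeasure (P n)]
    (u : ∀ n, Ω n → PolarBEC.Idx n → ZMod 2) (y : ∀ n, Ω n → PolarBEC.Idx n → Option (ZMod 2))
    (hy : ∀ n, PolarBEC.IsTransmission ε (A n) (P n) (u n) (y n))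
    -- the decoder, with any (possibly random) choice of the reference variables
    (nr ne : ∀ n, Ω n → ℕ) (hnr : ∀ n, Measurable (nr n)) (hne : ∀ n, Measurable (ne n))
    (hrun : ∀ n, ∀ᵐ ω ∂P n,
      PolarBEC.IsDecoderRun (H n) (PolarBEC.channelInfo (y n ω)) (nr n ω) (ne n ω))
    (q p : ℝ) (hq : 0 < q) (hp : 0 < p) :
    (∀ n, Integrable (fun ω => ((2 : ℝ) ^ n * Real.log ((2 : ℝ) ^ n)) *
      (nr n ω : ℝ) ^ q * (ne n ω : ℝ) ^ p) (P n)) ∧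
    Tendsto (fun n : ℕ => ∫ ω, ((2 : ℝ) ^ n * Real.log ((2 : ℝ) ^ n)) *
      (nr n ω : ℝ) ^ q * (ne n ω : ℝ) ^ p ∂P n) atTop (𝓝 0) := by

  have hlog : ∀ n : ℕ, 0 ≤ (2 : ℝ) ^ n * Real.log ((2 : ℝ) ^ n) := fun n =>
    mul_nonneg (by positivity) (Real.log_nonneg (one_le_pow₀ (by norm_num)))
  have key := fun n => PolarBEC.integral_decoder_le (hH n) (hy n) (hnr n) (hne n) (hrun n) hq hp
    (hlog n)
  refine ⟨fun n => (key n).1, ?_⟩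
  refine tendsto_of_tendsto_of_tendsto_of_le_of_le' tendsto_const_nhds
    (PolarBEC.tendsto_expectation_bound q hp) ?_ ?_
  · refine Eventually.of_forall fun n => integral_nonneg fun ω => ?_
    have := hlog n
    positivity
  · filter_upwards [PolarBEC.eventually_forall_bhattacharyya_le hε hR hK hA
      (c := q + p + 3) (by linarith)] with n hn
    refine (key n).2.trans (mul_le_mul_of_nonneg_left ?_ ?_)
    · have hcard : ((A n).card : ℝ) ≤ 2 ^ n := by
        have := Finset.card_le_univ (A n)
        simp only [Fintype.card_fun, Fintype.card_fin] at this
        exact_mod_cast this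
      refine (Finset.sum_le_card_nsmul _ _ _ hn).trans ?_
      rw [nsmul_eq_mul]
      exact mul_le_mul_of_nonneg_right hcard (by positivity)
    · have := hlog n
      positivity
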